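/- Let $q=2^r$ with $r\ge 1$, let $\mathbb{F}_q$ be the field with $q$ elements, and let $n$ be an odd positive integer. Let $O(2n+1,q)$ be the group of all invertible $(2n+1)\times(2n+1)$ matrices over $\mathbb{F}_q$ that preserve the quadratic form $\theta(x)=\sum_{i=1}^{n}x_ix_{n+i}+x_{2n+1}^2$ on column vectors $x\in\mathbb{F}_q^{2n+1}$. Call an $n\times n$ matrix $(a_{ij})$ alternating if $a_{ii}=0$ and $a_{ij}=-a_{ji}$ for all $i,j$, and let $P\le O(2n+1,q)$ be the maximal parabolic subgroup $$P=\left\{\begin{bmatrix}A&0&0\\0&{}^tA^{-1}&0\\0&0&1\end{bmatrix}\begin{bmatrix}1_n&B&0\\0&1_n&0\\0&h&1\end{bmatrix}\ \middle|\ A\in GL(n,q),\ B\in\mathbb{F}_q^{n\times n},\ h\in\mathbb{F}_q^{1\times n},\ B+{}^th\,h\text{ alternating}\right\}.$$ Let $\sigma_{n-1}\in O(2n+1,q)$ be the permutation matrix that exchanges the coordinates $i$ and $n+i$ for $1\le i\le n-1$ and fixes the coordinates $n$, $2n$ and $2n+1$, and put $DC(n,q)=P\sigma_{n-1}P$. Then,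 for every nontrivial additive character $\psi$ of $\mathbb{F}_q$, $$\sum_{w\in DC(n,q)}\psi(\operatorname{Tr}w)=\psi(1)\,A(n,q)\,K(\psi;1),$$ where $\operatorname{Tr}$ is the matrix trace, $K(\psi;a)=\sum_{\alpha\in\mathbb{F}_q^*}\psi(\alpha+a\alpha^{-1})$ for $a\in\mathbb{F}_q^*$ is the Kloosterman sum, and $$A(n,q)=q^{\frac14(5n^2-1)}\begin{bmatrix}n\\1\end{bmatrix}_q\prod_{j=1}^{(n-1)/2}(q^{2j-1}-1),\qquad \begin{bmatrix}n\\1\end{bmatrix}_q=\frac{q^n-1}{q-1}.$$ -/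

import Mathlib

open Matrix

/-- The index set of the coordinates `1, …, 2n+1`, split as
`{1, …, n} ⊔ {n+1, …, 2n} ⊔ {2n+1}`, which is the block structure used below. -/
abbrev OddIdx (n : ℕ) : Type := (Fin n ⊕ Fin n) ⊕ Unit

/-- The quadratic form `θ(x) = ∑_{i=1}^{n} x_i x_{n+i} + x_{2n+1}^2` on column vectors. -/
def theta (n : ℕ) (F : Type*) [CommRing F] : QuadraticForm F (OddIdx n → F) :=
  (∑ i : Fin n, QuadraticMap.proj (Sum.inl (Sum.inl i)) (Sum.inl (Sum.inr i)))
    + QuadraticMap.proj (Sum.inr ()) (Sum.inr ())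

theorem theta_apply {n : ℕ} {F : Type*} [CommRing F] (x : OddIdx n → F) :
    theta n F x = (∑ i : Fin n, x (Sum.inl (Sum.inl i)) * x (Sum.inl (Sum.inr i)))
      + x (Sum.inr ()) * x (Sum.inr ()) := by
  simp [theta]

/-- The orthogonal group `O(2n+1, F)`: all invertible matrices that are isometries of `θ`. -/
def OddOrthogonal (n : ℕ) (F : Type*) [CommRing F] : Subgroup (GL (OddIdx n) F) where
  carrier := {w | ∀ x : OddIdx n → F, theta n F ((w : Matrix (OddIdx n) (OddIdx n) F) *ᵥ x)
    = theta n F x}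
  mul_mem' := by
    intro a b ha hb x
    rw [Units.val_mul, ← Matrix.mulVec_mulVec, ha, hb]
  one_mem' := by
    intro x
    simp
  inv_mem' := by
    intro a ha x
    rw [← ha, Matrix.mulVec_mulVec, ← Units.val_mul, mul_inv_cancel, Units.val_one,
      Matrix.one_mulVec]

/-- The underlying `(2n+1) × (2n+1)` matrix of an element of `O(2n+1, F)`. -/
def oddMat {n : ℕ} {F : Type*} [CommRing F] (w : OddOrthogonal n F) :
    Matrix (OddIdx n) (OddIdx n) F :=
  ((w : GL (OddIdx n) F) : Matrix (OddIdx n) (OddIdx n) F)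

/-- A square matrix `(a_ij)` is alternating if `a_ii = 0` and `a_ij = -a_ji`. -/
def IsAlternatingMatrix {n : ℕ} {F : Type*} [CommRing F] (M : Matrix (Fin n) (Fin n) F) : Prop :=
  (∀ i, M i i = 0) ∧ ∀ i j, M i j = -M j i

/-- The block matrix `[A 0 0; 0 ᵗA⁻¹ 0; 0 0 1]`. -/
def leviMatrix {n : ℕ} {F : Type*} [CommRing F] (A : GL (Fin n) F) :
    Matrix (OddIdx n) (OddIdx n) F :=
  fromBlocks (fromBlocks (A : Matrix (Fin n) (Fin n) F) 0 0
    ((A⁻¹ : GL (Fin n) F) : Matrix (Fin n) (Fin n) F)ᵀ) 0 0 1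

/-- The block matrix `[1 B 0; 0 1 0; 0 h 1]`. -/
def unipotentMatrix {n : ℕ} {F : Type*} [CommRing F] (B : Matrix (Fin n) (Fin n) F)
    (h : Matrix Unit (Fin n) F) : Matrix (OddIdx n) (OddIdx n) F :=
  fromBlocks (fromBlocks 1 B 0 1) 0 (fromCols 0 h) 1

theorem leviMatrix_mul_unipotentMatrix {n : ℕ} {F : Type*} [CommRing F] (A : GL (Fin n) F)
    (B : Matrix (Fin n) (Fin n) F) (h : Matrix Unit (Fin n) F) :
    leviMatrix A * unipotentMatrix B h =
      fromBlocks (fromBlocks (A : Matrix (Fin n) (Fin n) F)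
        ((A : Matrix (Fin n) (Fin n) F) * B) 0
        ((A⁻¹ : GL (Fin n) F) : Matrix (Fin n) (Fin n) F)ᵀ) 0 (fromCols 0 h) 1 := by
  simp [leviMatrix, unipotentMatrix, fromBlocks_multiply]

theorem theta_levi_mul_unipotent {n : ℕ} {F : Type*} [CommRing F] (A : GL (Fin n) F)
    (B : Matrix (Fin n) (Fin n) F) (h : Matrix Unit (Fin n) F) (y : Fin n → F) :
    theta n F ((leviMatrix A * unipotentMatrix B h) *ᵥ (Sum.elim (Sum.elim 0 y) 0))
      = y ⬝ᵥ ((B + hᵀ * h) *ᵥ y) := by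
  have h1 : (leviMatrix A * unipotentMatrix B h) *ᵥ (Sum.elim (Sum.elim 0 y) 0)
      = Sum.elim (Sum.elim ((A : Matrix (Fin n) (Fin n) F) *ᵥ (B *ᵥ y))
        (((A⁻¹ : GL (Fin n) F) : Matrix (Fin n) (Fin n) F)ᵀ *ᵥ y)) (h *ᵥ y) := by
    rw [leviMatrix_mul_unipotentMatrix]
    simp [fromBlocks_mulVec, fromCols_mulVec, mulVec_mulVec]
  have h2 : ((A : Matrix (Fin n) (Fin n) F) *ᵥ (B *ᵥ y)) ⬝ᵥ
      (((A⁻¹ : GL (Fin n) F) : Matrix (Fin n) (Fin n) F)ᵀ *ᵥ y) = y ⬝ᵥ (B *ᵥ y) := by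
    rw [mulVec_transpose, dotProduct_comm, ← dotProduct_mulVec, mulVec_mulVec, ← Units.val_mul,
      inv_mul_cancel, Units.val_one, one_mulVec]
  have h3 : y ⬝ᵥ ((hᵀ * h) *ᵥ y) = (h *ᵥ y) () * (h *ᵥ y) () := by
    rw [← mulVec_mulVec, mulVec_transpose, dotProduct_comm, ← dotProduct_mulVec]
    simp [dotProduct]
  rw [h1, theta_apply, add_mulVec, dotProduct_add, h3, ← h2]
  simp [dotProduct]

theorem isAlternatingMatrix_of_form_eq_zero {n : ℕ} {F : Type*} [CommRing F]
    {M : Matrix (Fin n) (Fin n) F} (hM : ∀ y : Fin n → F, y ⬝ᵥ (M *ᵥ y) = 0) :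
    IsAlternatingMatrix M := by
  have hd : ∀ i, M i i = 0 := by
    intro i
    simpa using hM (Pi.single i 1)
  refine ⟨hd, fun i j => ?_⟩
  have := hM (Pi.single i 1 + Pi.single j 1)
  simp [add_dotProduct, mulVec_add, hd] at this
  linear_combination this

theorem isAlternatingMatrix_of_mat_eq {n : ℕ} {F : Type*} [CommRing F] (w : OddOrthogonal n F)
    {A : GL (Fin n) F} {B : Matrix (Fin n) (Fin n) F} {h : Matrix Unit (Fin n) F}
    (hw : oddMat w = leviMatrix A * unipotentMatrix B h) : IsAlternatingMatrix (B + hᵀ * h) := by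
  refine isAlternatingMatrix_of_form_eq_zero fun y => ?_
  rw [← theta_levi_mul_unipotent A, ← hw]
  refine (w.2 _).trans ?_
  simp [theta_apply]

/-- The maximal parabolic subgroup `P(2n+1, F)` of `O(2n+1, F)`. -/
def maxParabolic (n : ℕ) (F : Type*) [CommRing F] : Subgroup (OddOrthogonal n F) where
  carrier := {w | ∃ (A : GL (Fin n) F) (B : Matrix (Fin n) (Fin n) F) (h : Matrix Unit (Fin n) F),
    IsAlternatingMatrix (B + hᵀ * h) ∧ oddMat w = leviMatrix A * unipotentMatrix B h}
  mul_mem' := by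
    rintro v w ⟨A, B, h, -, hv⟩ ⟨A', B', h', -, hw⟩
    have key : oddMat (v * w) = leviMatrix (A * A') * unipotentMatrix
        (B' + ((A'⁻¹ : GL (Fin n) F) : Matrix (Fin n) (Fin n) F) * B *
          ((A'⁻¹ : GL (Fin n) F) : Matrix (Fin n) (Fin n) F)ᵀ)
        (h' + h * ((A'⁻¹ : GL (Fin n) F) : Matrix (Fin n) (Fin n) F)ᵀ) := by
      have e : oddMat (v * w) = oddMat v * oddMat w := rfl
      have c : ∀ X : Matrix (Fin n) (Fin n) F, (A' : Matrix (Fin n) (Fin n) F) *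
          (((A'⁻¹ : GL (Fin n) F) : Matrix (Fin n) (Fin n) F) * X) = X := by
        intro X
        rw [← Matrix.mul_assoc, ← Units.val_mul, mul_inv_cancel, Units.val_one, Matrix.one_mul]
      rw [e, hv, hw, leviMatrix_mul_unipotentMatrix, leviMatrix_mul_unipotentMatrix,
        leviMatrix_mul_unipotentMatrix, fromBlocks_multiply, fromBlocks_multiply,
        fromCols_mul_fromBlocks, _root_.mul_inv_rev, Units.val_mul, Units.val_mul, transpose_mul]
      simp only [Matrix.mul_zero, Matrix.zero_mul, add_zero, zero_add, Matrix.one_mul,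
        Matrix.mul_one, Matrix.mul_add, Matrix.mul_assoc, c]
      congr 1
      ext i (j | j) <;> simp [add_comm]
    exact ⟨_, _, _, isAlternatingMatrix_of_mat_eq _ key, key⟩
  one_mem' := by
    refine ⟨1, 0, 0, ⟨by simp, by simp⟩, ?_⟩
    rw [leviMatrix_mul_unipotentMatrix]
    simp [oddMat]
  inv_mem' := by
    rintro w ⟨A, B, h, -, hw⟩
    have key : oddMat w⁻¹ = leviMatrix A⁻¹ * unipotentMatrix
        (-((A : Matrix (Fin n) (Fin n) F) * B * (A : Matrix (Fin n) (Fin n) F)ᵀ))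
        (-(h * (A : Matrix (Fin n) (Fin n) F)ᵀ)) := by
      have c1 : ((A⁻¹ : GL (Fin n) F) : Matrix (Fin n) (Fin n) F)
          * (A : Matrix (Fin n) (Fin n) F) = 1 := by
        rw [← Units.val_mul, inv_mul_cancel, Units.val_one]
      have c2 : (A : Matrix (Fin n) (Fin n) F)
          * ((A⁻¹ : GL (Fin n) F) : Matrix (Fin n) (Fin n) F) = 1 := by
        rw [← Units.val_mul, mul_inv_cancel, Units.val_one]
      have c3 : ((A⁻¹ : GL (Fin n) F) : Matrix (Fin n) (Fin n) F)ᵀ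
          * (A : Matrix (Fin n) (Fin n) F)ᵀ = 1 := by
        rw [← transpose_mul, c2, transpose_one]
      have e : oddMat w * oddMat w⁻¹ = 1 := by
        change oddMat (w * w⁻¹) = 1
        rw [mul_inv_cancel]
        rfl
      have f : oddMat w * (leviMatrix A⁻¹ * unipotentMatrix
          (-((A : Matrix (Fin n) (Fin n) F) * B * (A : Matrix (Fin n) (Fin n) F)ᵀ))
          (-(h * (A : Matrix (Fin n) (Fin n) F)ᵀ))) = 1 := by
        rw [hw, leviMatrix_mul_unipotentMatrix, leviMatrix_mul_unipotentMatrix,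
          fromBlocks_multiply, fromBlocks_multiply, fromCols_mul_fromBlocks, inv_inv]
        have c4 : ∀ X : Matrix (Fin n) (Fin n) F, ((A⁻¹ : GL (Fin n) F) : Matrix (Fin n) (Fin n) F)
          * ((A : Matrix (Fin n) (Fin n) F) * X) = X := by
          intro X
          rw [← Matrix.mul_assoc, c1, Matrix.one_mul]
        simp only [Matrix.mul_zero, Matrix.zero_mul, add_zero, zero_add, Matrix.one_mul,
          Matrix.mul_neg, Matrix.mul_assoc, c2, c3, c4, neg_add_cancel, neg_zero]
        have : fromCols (0 : Matrix Unit (Fin n) F) (h * (A : Matrix (Fin n) (Fin n) F)ᵀ)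
            + fromCols 0 (-(h * (A : Matrix (Fin n) (Fin n) F)ᵀ)) = 0 := by
          ext i (j | j) <;> simp
        rw [this, fromBlocks_one, fromBlocks_one]
      have g : oddMat w⁻¹ * oddMat w = 1 := by
        change oddMat (w⁻¹ * w) = 1
        rw [inv_mul_cancel]
        rfl
      calc oddMat w⁻¹ = oddMat w⁻¹ * 1 := (Matrix.mul_one _).symm
        _ = _ := by rw [← f, ← Matrix.mul_assoc, g, Matrix.one_mul]
    exact ⟨_, _, _, isAlternatingMatrix_of_mat_eq _ key, key⟩

/-- The matrix `σ_r`: it exchanges the coordinates `i` and `n+i` for `1 ≤ i ≤ r` and fixes the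
other coordinates. -/
def sigmaMatrix (n : ℕ) (F : Type*) [CommRing F] (r : ℕ) : Matrix (OddIdx n) (OddIdx n) F :=
  fromBlocks
    (fromBlocks
      (diagonal fun i : Fin n => if (i : ℕ) < r then 0 else 1)
      (diagonal fun i : Fin n => if (i : ℕ) < r then 1 else 0)
      (diagonal fun i : Fin n => if (i : ℕ) < r then 1 else 0)
      (diagonal fun i : Fin n => if (i : ℕ) < r then 0 else 1)) 0 0 1

theorem sigmaMatrix_mul_self (n : ℕ) (F : Type*) [CommRing F] (r : ℕ) :
    sigmaMatrix n F r * sigmaMatrix n F r = 1 := by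
  rw [sigmaMatrix, fromBlocks_multiply, fromBlocks_multiply]
  simp only [diagonal_mul_diagonal, diagonal_add, Matrix.mul_zero, Matrix.zero_mul, add_zero,
    zero_add, Matrix.mul_one]
  rw [← fromBlocks_one, ← fromBlocks_one, ← diagonal_one, ← diagonal_zero]
  congr 2 <;> · congr 1; funext i; split_ifs <;> simp

/-- The element `σ_r` of `O(2n+1, F)`. -/
def sigma (n : ℕ) (F : Type*) [CommRing F] (r : ℕ) : OddOrthogonal n F :=
  ⟨⟨sigmaMatrix n F r, sigmaMatrix n F r, sigmaMatrix_mul_self n F r, sigmaMatrix_mul_self n F r⟩,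
    by
      intro x
      rw [theta_apply, theta_apply]
      simp only [sigmaMatrix, fromBlocks_mulVec, mulVec_diagonal, Sum.elim_inl, Sum.elim_inr,
        zero_mulVec, one_mulVec, Pi.add_apply, add_zero, zero_add,
        Function.comp_apply]
      congr 1
      refine Finset.sum_congr rfl fun i _ => ?_
      split_ifs <;> simp [mul_comm]⟩

/-- The double coset `DC(n, q) = P σ_{n-1} P` in `O(2n+1, F)` (used for `n ≥ 1`). -/
def DC (n : ℕ) (F : Type*) [CommRing F] : Set (OddOrthogonal n F) :=
  DoubleCoset.doubleCoset (sigma n F (n - 1)) (maxParabolic n F) (maxParabolic n F)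

/-- The Kloosterman sum `K(ψ; a) = ∑_{α ∈ F^*} ψ(α + a α⁻¹)`. -/
def kloosterman {F : Type*} [Field F] [Fintype F] [DecidableEq F] (ψ : AddChar F ℂ) (a : Fˣ) : ℂ :=
  ∑ α : Fˣ, ψ ((α : F) + (a : F) * ((α⁻¹ : Fˣ) : F))

/-- The `q`-binomial coefficient `∏_{j=0}^{r-1} (q^{n-j} - 1) / (q^{r-j} - 1)` (for `r ≤ n`). -/
def qBinomial (n r q : ℕ) : ℚ :=
  ∏ j ∈ Finset.range r, ((q : ℚ) ^ (n - j) - 1) / ((q : ℚ) ^ (r - j) - 1)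

/-- `A(n, q) = q^{(5n² - 1)/4} [n choose 1]_q ∏_{j=1}^{(n-1)/2} (q^{2j-1} - 1)`, for odd `n`;
then `5n² - 1` is divisible by `4` and `n - 1` by `2`. -/
def Acoeff (n q : ℕ) : ℚ :=
  (q : ℚ) ^ ((5 * n ^ 2 - 1) / 4) * qBinomial n 1 q *
    ∏ j ∈ Finset.Icc 1 ((n - 1) / 2), ((q : ℚ) ^ (2 * j - 1) - 1)

/-! Write n = m + 1, σ = σ_m, and let E be the projection killing the last coordinate. Since ψ ∘ Tr
is invariant under cyclic permutation of factors, the sum over PσP is |P| / |P ∩ σ⁻¹Pσ| times the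
sum of ψ(Tr pσ) over p in P (`card_mul_sum_doubleCoset`). In characteristic 2 the group P is
parametrized freely by A in GL(n), an alternating C and a row h, with B = C - ᵗh h, and Tr pσ = A_nn
+ (A⁻¹)_nn + 1 + Tr(EAB).

For fixed A, the sum over C vanishes unless EA is symmetric; for symmetric EA, the sum over h
vanishes unless the diagonal is zero (`sum_altMatrices_sum_row`). Hence only A with EA alternating
survive. These are A = [S 0; g a] with S nonsingular alternating of size m, and summing ψ(a + a⁻¹ +
1) over a gives ψ(1) K(ψ; 1) (`sum_GL_alternating`). As n is odd, m is even; the number of such S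
(`numAltNonsing_fin`) supplies the product in A(n, q). The orders of P and of the intersection
(`card_maxParabolic`, `card_sigma_conj`) supply the q-binomial, and the rest is powers of q. -/

/-! ### Alternating matrices and the count of nonsingular ones -/

/-- The additive group of alternating matrices. -/
def altMatrices (ι R : Type*) [CommRing R] : AddSubgroup (Matrix ι ι R) where
  carrier := {M | (∀ i, M i i = 0) ∧ ∀ i j, M i j = -M j i}
  add_mem' := by
    rintro a b ⟨ha, ha'⟩ ⟨hb, hb'⟩
    refine ⟨fun i => by simp [ha, hb], fun i j => ?_⟩
    simp only [Matrix.add_apply]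
    rw [ha' i j, hb' i j]; ring
  zero_mem' := ⟨by simp, by simp⟩
  neg_mem' := by
    rintro a ⟨ha, ha'⟩
    exact ⟨fun i => by simp [ha], fun i j => by simp [ha' i j]⟩

theorem mem_altMatrices {ι R : Type*} [CommRing R] {M : Matrix ι ι R} :
    M ∈ altMatrices ι R ↔ (∀ i, M i i = 0) ∧ ∀ i j, M i j = -M j i := Iff.rfl

/-- Off-diagonal terms cancel in pairs under swapping the indices. The diagonal needs its own
hypothesis, because in characteristic 2 antisymmetry does not make it vanish. -/
theorem sum_mul_eq_zero_of_alternating {ι R : Type*} [Fintype ι] [CommRing R]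
    {f : ι → ι → R} (h0 : ∀ i, f i i = 0) (h1 : ∀ i j, f i j = -f j i) :
    ∑ i, ∑ j, f i j = 0 := by
  classical
  rw [← Fintype.sum_prod_type']
  refine Finset.sum_involution (fun p _ => p.swap) ?_ ?_ (fun _ _ => Finset.mem_univ _) ?_
  · rintro ⟨i, j⟩ _
    simp [h1 i j]
  · rintro ⟨i, j⟩ _ h e
    obtain rfl : j = i := congrArg Prod.fst e
    exact h (h0 j)
  · rintro ⟨i, j⟩ _
    rfl

theorem dotProduct_mulVec_eq_zero_of_mem_altMatrices {ι R : Type*} [Fintype ι] [CommRing R]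
    {M : Matrix ι ι R} (hM : M ∈ altMatrices ι R) (y : ι → R) : y ⬝ᵥ (M *ᵥ y) = 0 := by
  simp only [dotProduct, mulVec, Finset.mul_sum]
  refine sum_mul_eq_zero_of_alternating (fun i => by simp [hM.1]) fun i j => ?_
  rw [hM.2 i j]; ring

theorem mul_mul_transpose_mem_altMatrices {ι κ R : Type*} [Fintype ι] [CommRing R]
    {M : Matrix ι ι R} (hM : M ∈ altMatrices ι R) (G : Matrix κ ι R) :
    G * M * Gᵀ ∈ altMatrices κ R := by
  have e : ∀ i j, (G * M * Gᵀ) i j = ∑ k, ∑ l, G i k * M k l * G j l := by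
    intro i j
    rw [Finset.sum_comm]
    simp [Matrix.mul_apply, Finset.sum_mul]
  refine ⟨fun i => ?_, fun i j => ?_⟩
  · rw [e]
    refine sum_mul_eq_zero_of_alternating (fun i => by simp [hM.1]) fun i j => ?_
    rw [hM.2 i j]; ring
  · rw [e, e, Finset.sum_comm, ← Finset.sum_neg_distrib]
    refine Finset.sum_congr rfl fun k _ => ?_
    rw [← Finset.sum_neg_distrib]
    refine Finset.sum_congr rfl fun l _ => ?_
    rw [hM.2 l k]; ring

/-- Adding a first row and column to an alternating matrix. -/
def altBorder {ι R : Type*} [CommRing R] (v : ι → R) (M : Matrix ι ι R) :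
    Matrix (Unit ⊕ ι) (Unit ⊕ ι) R :=
  fromBlocks 0 (replicateRow Unit v) (-replicateCol Unit v) M

theorem altBorder_mem {ι R : Type*} [CommRing R] (v : ι → R) {M : Matrix ι ι R}
    (hM : M ∈ altMatrices ι R) : altBorder v M ∈ altMatrices (Unit ⊕ ι) R := by
  refine ⟨?_, ?_⟩
  · rintro (i | i) <;> simp [altBorder, hM.1]
  · rintro (i | i) (j | j)
    · simp [altBorder]
    · simp [altBorder]
    · simp [altBorder]
    · simpa [altBorder] using hM.2 i j

/-- An alternating matrix is determined by its first row and the remaining block. -/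
def altBorderEquiv (ι R : Type*) [CommRing R] :
    (ι → R) × altMatrices ι R ≃ altMatrices (Unit ⊕ ι) R where
  toFun p := ⟨altBorder p.1 p.2, altBorder_mem p.1 p.2.2⟩
  invFun N := (fun i => N.1 (Sum.inl ()) (Sum.inr i), ⟨N.1.toBlocks₂₂,
    fun i => N.2.1 _, fun i j => N.2.2 _ _⟩)
  left_inv := by
    rintro ⟨v, M, hM⟩
    rfl
  right_inv := by
    rintro ⟨N, hN⟩
    refine Subtype.ext ?_
    ext (i | i) (j | j)
    · simp [altBorder, hN.1]
    · simp [altBorder]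
    · simp [altBorder, hN.2 (Sum.inr i) (Sum.inl ())]
    · simp [altBorder, toBlocks₂₂]

/-- Renaming the indices of alternating matrices. -/
def altReindex {ι κ : Type*} (R : Type*) [CommRing R] (e : ι ≃ κ) :
    altMatrices ι R ≃ altMatrices κ R :=
  (reindex e e).subtypeEquiv fun M => by
    simp only [mem_altMatrices, reindex_apply, submatrix_apply]
    constructor
    · exact fun h => ⟨fun i => h.1 _, fun i j => h.2 _ _⟩
    · exact fun h => ⟨fun i => by simpa using h.1 (e i), fun i j => by simpa using h.2 (e i) (e j)⟩

theorem card_altMatrices (F : Type*) [Field F] [Fintype F] (n : ℕ) :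
    Nat.card (altMatrices (Fin n) F) = Fintype.card F ^ (n * (n - 1) / 2) := by
  rw [← Nat.choose_two_right]
  induction n with
  | zero => simp
  | succ n ih =>
    rw [Nat.card_congr (altReindex F (finSumFinEquiv (m := n) (n := 1)).symm),
      Nat.card_congr (altReindex F (Equiv.sumComm _ _)),
      Nat.card_congr (altReindex F (Equiv.sumCongr (Equiv.equivPUnit (Fin 1)) (Equiv.refl _))),
      ← Nat.card_congr (altBorderEquiv _ F), Nat.card_prod, ih, Nat.card_fun, Nat.choose_succ_left _ _ (by norm_num)]
    simp [pow_add]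

/-- The isomorphism between the lines spanned by `v` and `w` extends to an automorphism of the whole
space. -/
theorem exists_det_ne_zero_mulVec_eq {ι F : Type*} [Fintype ι] [DecidableEq ι] [Field F]
    {v w : ι → F} (hv : v ≠ 0) (hw : w ≠ 0) :
    ∃ G : Matrix ι ι F, G.det ≠ 0 ∧ G *ᵥ v = w := by
  obtain ⟨g, hg⟩ := Submodule.exists_linearEquiv_restrict_eq
    ((LinearEquiv.toSpanNonzeroSingleton F _ v hv).symm.trans
      (LinearEquiv.toSpanNonzeroSingleton F _ w hw))
  refine ⟨LinearMap.toMatrix' (g : (ι → F) →ₗ[F] (ι → F)), ?_, ?_⟩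
  · rw [LinearMap.det_toMatrix']
    exact (LinearEquiv.isUnit_det' g).ne_zero
  · rw [LinearMap.toMatrix'_mulVec]
    have := hg ⟨v, Submodule.mem_span_singleton_self v⟩
    have h1 : (LinearEquiv.toSpanNonzeroSingleton F _ v hv).symm
        ⟨v, Submodule.mem_span_singleton_self v⟩ = 1 := by
      rw [LinearEquiv.symm_apply_eq]
      ext
      simp
    rw [LinearEquiv.trans_apply, h1] at this
    simpa using this.symm

/-- The number of nonsingular alternating matrices. -/
noncomputable def numAltNonsing (ι F : Type*) [Fintype ι] [DecidableEq ι] [Field F] : ℕ :=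
  Nat.card {M : altMatrices ι F // M.1.det ≠ 0}

theorem numAltNonsing_congr {ι κ : Type*} (F : Type*) [Fintype ι] [DecidableEq ι] [Fintype κ]
    [DecidableEq κ] [Field F] (e : ι ≃ κ) : numAltNonsing ι F = numAltNonsing κ F :=
  Nat.card_congr ((altReindex F e).subtypeEquiv fun M => by
    simp [altReindex, Equiv.subtypeEquiv_apply, det_submatrix_equiv_self])

theorem altBorder_congruence {ι F : Type*} [Fintype ι] [DecidableEq ι] [Field F]
    (v : ι → F) (M G : Matrix ι ι F) :
    altBorder (G *ᵥ v) (G * M * Gᵀ) =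
      fromBlocks 1 0 0 G * altBorder v M * (fromBlocks 1 0 0 G : Matrix (Unit ⊕ ι) (Unit ⊕ ι) F)ᵀ := by
  simp only [altBorder, fromBlocks_transpose, fromBlocks_multiply]
  congr 1 <;> simp
  · ext i j; simp [Matrix.mul_apply, mulVec, dotProduct, mul_comm]
  · ext i j; simp [Matrix.mul_apply, mulVec, dotProduct]

/-- The number of nonsingular alternating matrices with a prescribed first row. -/
noncomputable def numAltNonsingRow {ι F : Type*} [Fintype ι] [DecidableEq ι] [Field F]
    (v : ι → F) : ℕ :=
  Nat.card {M : altMatrices ι F // (altBorder v M.1).det ≠ 0}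

/-- Congruence by diag(1, G) with G v = w preserves nonsingularity and is injective on the remaining
block. Exchanging the two rows gives equality, so the count is the same for every nonzero first row.
-/
theorem numAltNonsingRow_le {ι F : Type*} [Fintype ι] [DecidableEq ι] [Field F] [Finite F]
    {v w : ι → F} (hv : v ≠ 0) (hw : w ≠ 0) : numAltNonsingRow v ≤ numAltNonsingRow w := by
  obtain ⟨G, hG, rfl⟩ := exists_det_ne_zero_mulVec_eq hv hw
  have hu : IsUnit G := (isUnit_iff_isUnit_det G).2 hG.isUnit
  have hu' : IsUnit Gᵀ := (isUnit_iff_isUnit_det Gᵀ).2 (by rw [det_transpose]; exact hG.isUnit)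
  refine Nat.card_le_card_of_injective
    (fun M => ⟨⟨G * M.1.1 * Gᵀ, mul_mul_transpose_mem_altMatrices M.1.2 G⟩, ?_⟩) ?_
  · rw [altBorder_congruence, det_mul, det_mul, det_transpose]
    simpa [hG] using M.2
  · intro M N h
    have h' : G * M.1.1 * Gᵀ = G * N.1.1 * Gᵀ := congrArg (fun x => x.1.1) h
    exact Subtype.ext (Subtype.ext (hu.mul_left_cancel (hu'.mul_right_cancel h')))

theorem numAltNonsingRow_zero {ι F : Type*} [Fintype ι] [DecidableEq ι] [Field F] :
    numAltNonsingRow (0 : ι → F) = 0 := by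
  have : IsEmpty {M : altMatrices ι F // (altBorder 0 M.1).det ≠ 0} := by
    refine ⟨fun M => M.2 (det_eq_zero_of_row_eq_zero (Sum.inl ()) ?_)⟩
    rintro (j | j) <;> simp [altBorder]
  simp [numAltNonsingRow]

/-- The leading 2 × 2 block is the symplectic matrix of determinant 1. The off-diagonal blocks
involve only its second index, where the inverse has zero diagonal entry, so the Schur complement of
the block is `M` itself. In particular `w` is arbitrary. -/
theorem det_altBorder_altBorder {κ F : Type*} [Fintype κ] [DecidableEq κ] [Field F]
    (w : κ → F) (M : Matrix κ κ F) :
    (altBorder (Sum.elim 1 0) (altBorder w M)).det = M.det := by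
  have h1 : (!![0, 1; -1, 0] : Matrix (Fin 2) (Fin 2) F) * !![0, -1; 1, 0] = 1 := by
    simp [one_fin_two]
  let _ : Invertible (!![0, 1; -1, 0] : Matrix (Fin 2) (Fin 2) F) :=
    invertibleOfRightInverse _ _ h1
  have h2 : ⅟(!![0, 1; -1, 0] : Matrix (Fin 2) (Fin 2) F) = !![0, -1; 1, 0] := rfl
  let e : Unit ⊕ (Unit ⊕ κ) ≃ Fin 2 ⊕ κ :=
    (Equiv.sumAssoc Unit Unit κ).symm.trans (Equiv.sumCongr
      ((Equiv.sumCongr (Equiv.equivPUnit (Fin 1)).symm (Equiv.equivPUnit (Fin 1)).symm).trans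
        finSumFinEquiv) (Equiv.refl _))
  have h3 : altBorder (Sum.elim 1 0) (altBorder w M) =
      (fromBlocks !![0, 1; -1, 0] (of ![0, w]) (of fun i => ![0, -w i]) M).submatrix e e := by
    ext (i | i | i) (j | j | j) <;> simp [altBorder, e, finSumFinEquiv]
  rw [h3, det_submatrix_equiv_self, det_fromBlocks₁₁, h2]
  have h4 : (of fun i => ![0, -w i] : Matrix κ (Fin 2) F) *
      (!![0, -1; 1, 0] : Matrix (Fin 2) (Fin 2) F) * of ![0, w] = 0 := by
    ext i j
    simp [Matrix.mul_apply, Fin.sum_univ_two]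
  rw [h4]
  simp [det_fin_two]

theorem numAltNonsingRow_single {κ F : Type*} [Fintype κ] [DecidableEq κ] [Field F] [Fintype F] :
    numAltNonsingRow (Sum.elim 1 0 : Unit ⊕ κ → F) =
      Fintype.card F ^ Fintype.card κ * numAltNonsing κ F := by
  have e : {M : altMatrices (Unit ⊕ κ) F // (altBorder (Sum.elim 1 0) M.1).det ≠ 0} ≃
      (κ → F) × {M : altMatrices κ F // M.1.det ≠ 0} :=
    ((altBorderEquiv κ F).subtypeEquiv (p := fun p => p.2.1.det ≠ 0) (fun p => by
      rw [← det_altBorder_altBorder p.1 p.2.1]; rfl)).symm.trans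
      ⟨fun x => (x.1.1, ⟨x.1.2, x.2⟩), fun x => ⟨(x.1, x.2.1), x.2.2⟩, fun _ => rfl, fun _ => rfl⟩
  rw [numAltNonsingRow, Nat.card_congr e, Nat.card_prod, Nat.card_fun]
  simp [numAltNonsing]

theorem numAltNonsing_border {ι F : Type*} [Fintype ι] [DecidableEq ι] [Field F] [Fintype F] :
    numAltNonsing (Unit ⊕ ι) F = ∑ᶠ v : ι → F, numAltNonsingRow v := by
  classical
  have e : {M : altMatrices (Unit ⊕ ι) F // M.1.det ≠ 0} ≃
      Σ v : ι → F, {M : altMatrices ι F // (altBorder v M.1).det ≠ 0} :=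
    ((altBorderEquiv ι F).subtypeEquiv (p := fun p => (altBorder p.1 p.2.1).det ≠ 0)
      (fun p => Iff.rfl)).symm.trans
      ⟨fun x => ⟨x.1.1, ⟨x.1.2, x.2⟩⟩, fun x => ⟨(x.1, x.2.1), x.2.2⟩, fun _ => rfl, fun _ => rfl⟩
  rw [numAltNonsing, Nat.card_congr e, Nat.card_sigma, finsum_eq_sum_of_fintype]
  rfl

/-- A zero first row contributes nothing, and each nonzero one contributes as much as (1, 0, …, 0).
-/
theorem numAltNonsing_border_border {κ F : Type*} [Fintype κ] [DecidableEq κ] [Field F]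
    [Fintype F] : numAltNonsing (Unit ⊕ (Unit ⊕ κ)) F =
      (Fintype.card F ^ (Fintype.card κ + 1) - 1) *
        (Fintype.card F ^ Fintype.card κ * numAltNonsing κ F) := by
  classical
  have h1 : (Sum.elim 1 0 : Unit ⊕ κ → F) ≠ 0 := fun h => by
    simpa using congrFun h (Sum.inl ())
  rw [numAltNonsing_border, finsum_eq_sum_of_fintype,
    ← Finset.add_sum_erase _ _ (Finset.mem_univ (0 : Unit ⊕ κ → F)), numAltNonsingRow_zero, zero_add,
    Finset.sum_congr rfl (g := fun _ => numAltNonsingRow (Sum.elim 1 0 : Unit ⊕ κ → F))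
      (fun v hv => le_antisymm (numAltNonsingRow_le (Finset.ne_of_mem_erase hv) h1)
        (numAltNonsingRow_le h1 (Finset.ne_of_mem_erase hv))), numAltNonsingRow_single]
  simp [Finset.card_erase_of_mem, add_comm]

theorem numAltNonsing_fin (F : Type*) [Field F] [Fintype F] (k : ℕ) :
    numAltNonsing (Fin (2 * k)) F =
      Fintype.card F ^ (k * (k - 1)) * ∏ j ∈ Finset.range k, (Fintype.card F ^ (2 * j + 1) - 1) := by
  induction k with
  | zero =>
    have : Unique {M : altMatrices (Fin (2 * 0)) F // M.1.det ≠ 0} :=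
      { default := ⟨0, by simp⟩
        uniq := fun M => Subtype.ext (Subtype.ext (Matrix.ext fun i => i.elim0)) }
    simp [numAltNonsing]
  | succ k ih =>
    have e : Fin (2 * (k + 1)) ≃ Unit ⊕ (Unit ⊕ Fin (2 * k)) :=
      Fintype.equivOfCardEq (by simp; ring)
    rw [numAltNonsing_congr F e, numAltNonsing_border_border, ih, Finset.prod_range_succ,
      Fintype.card_fin]
    have : (k + 1) * (k + 1 - 1) = 2 * k + k * (k - 1) := by
      cases k <;> simp; ring
    rw [this, pow_add]; ring

/-! ### Sums of trace-like functions over a double coset -/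

/-- Evaluate the sum of f(x s y) over H × H in two ways: cyclicity turns it into |H| copies of the
sum of f(p s), while each fibre of (x, y) ↦ x s y over the double coset is a torsor under H ∩ s⁻¹Hs.
-/
theorem card_mul_sum_doubleCoset {G : Type*} [Group G] [Finite G] (H : Subgroup G) [Fintype H]
    (s : G) (f : G → ℂ) (hf : ∀ a b, f (a * b) = f (b * a)) :
    (Nat.card {a : H // s * a * s⁻¹ ∈ H} : ℂ) *
      ∑ w ∈ (Set.toFinite (DoubleCoset.doubleCoset s (H : Set G) H)).toFinset, f w =
    Nat.card H * ∑ p : H, f (p * s) := by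
  classical
  have h1 : ∑ x : H × H, f (x.1 * s * x.2) = Nat.card H * ∑ p : H, f (p * s) := by
    rw [Fintype.sum_prod_type_right, Nat.card_eq_fintype_card, ← nsmul_eq_mul,
      ← Finset.card_univ, ← Finset.sum_const]
    refine Finset.sum_congr rfl fun b _ => ?_
    refine Fintype.sum_equiv (Equiv.mulLeft b) _ _ fun a => ?_
    rw [hf, Equiv.coe_mulLeft, Subgroup.coe_mul, mul_assoc]
  have hmem : ∀ x ∈ (Finset.univ : Finset (H × H)), (x.1 * s * x.2 : G) ∈
      (Set.toFinite (DoubleCoset.doubleCoset s (H : Set G) H)).toFinset := by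
    intro x _
    rw [Set.Finite.mem_toFinset, DoubleCoset.mem_doubleCoset]
    exact ⟨x.1, x.1.2, x.2, x.2.2, rfl⟩
  rw [← h1, ← Finset.sum_fiberwise_of_maps_to hmem, Finset.mul_sum]
  refine Finset.sum_congr rfl fun w hw => ?_
  rw [Set.Finite.mem_toFinset, DoubleCoset.mem_doubleCoset] at hw
  obtain ⟨p, hp, r, hr, rfl⟩ := hw
  rw [Finset.sum_congr rfl (g := fun _ => f (p * s * r))
    (fun x hx => by rw [(Finset.mem_filter.1 hx).2]), Finset.sum_const, nsmul_eq_mul]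
  congr 2
  rw [← Fintype.card_subtype, ← Nat.card_eq_fintype_card]
  have e1 : ∀ a : G, p * (s * a * s⁻¹) * s * (a⁻¹ * r) = p * s * r := fun a => by group
  have e2 : ∀ x y : G, x * s * y = p * s * r → s * (r * y⁻¹) * s⁻¹ = p⁻¹ * x := fun x y h => by
    rw [← mul_assoc, mul_inv_eq_iff_eq_mul, mul_inv_eq_iff_eq_mul, mul_assoc, mul_assoc,
      ← mul_assoc x, h]
    group
  -- The fibre through (p, r) consists of the pairs (p · s a s⁻¹, a⁻¹ r), and a is recovered from
  -- the second component.
  refine Nat.card_congr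
    { toFun := fun a => ⟨(⟨p * (s * a.1 * s⁻¹), H.mul_mem hp a.2⟩,
        ⟨a.1⁻¹ * r, H.mul_mem (H.inv_mem a.1.2) hr⟩), e1 _⟩
      invFun := fun x => ⟨⟨r * (x.1.2 : G)⁻¹, H.mul_mem hr (H.inv_mem x.1.2.2)⟩, by
        rw [e2 _ _ x.2]
        exact H.mul_mem (H.inv_mem hp) x.1.1.2⟩
      left_inv := fun a => Subtype.ext (Subtype.ext (by simp))
      right_inv := fun x => Subtype.ext (Prod.ext (Subtype.ext ?_) (Subtype.ext (by simp))) }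
  change p * (s * (r * (x.1.2 : G)⁻¹) * s⁻¹) = x.1.1
  rw [e2 _ _ x.2, mul_inv_cancel_left]

/-! ### Character sums detecting alternating matrices -/

/-- Translation by an element whose image has nontrivial character value rescales the sum. Only
additivity of `φ` is required, since it is later applied to a quadratic form that is additive but
not linear. -/
theorem sum_addChar_eq_zero {A F : Type*} [AddCommGroup A] [Fintype A] [Field F]
    (ψ : AddChar F ℂ) (hψ : ψ ≠ 1) (φ : A → F) (hφ : ∀ a b, φ (a + b) = φ a + φ b)
    (hs : Function.Surjective φ) : ∑ a, ψ (φ a) = 0 := by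
  obtain ⟨x, hx⟩ := AddChar.ne_one_iff.1 hψ
  obtain ⟨a, rfl⟩ := hs x
  refine eq_zero_of_mul_eq_self_left hx ?_
  rw [Finset.mul_sum]
  exact Fintype.sum_equiv (Equiv.addLeft a) _ _ fun y => by
    simp [hφ, AddChar.map_add_eq_mul]

theorem trace_mul_eq_zero_of_symm {ι R : Type*} [Fintype ι] [CommRing R] {M C : Matrix ι ι R}
    (hM : ∀ i j, M i j = M j i) (hC : C ∈ altMatrices ι R) : (M * C).trace = 0 := by
  simp only [trace, diag_apply, Matrix.mul_apply]
  refine sum_mul_eq_zero_of_alternating (fun i => by simp [hC.1]) fun i j => ?_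
  rw [hC.2 i j, hM i j]; ring

theorem sum_altMatrices_eq_zero {ι F : Type*} [Fintype ι] [DecidableEq ι] [Field F]
    [Fintype (altMatrices ι F)] (ψ : AddChar F ℂ) (hψ : ψ ≠ 1) {M : Matrix ι ι F} {i j : ι}
    (hM : M i j ≠ M j i) : ∑ C : altMatrices ι F, ψ (M * C.1).trace = 0 := by
  refine sum_addChar_eq_zero ψ hψ _ (fun a b => by simp [Matrix.mul_add]) fun t => ?_
  have hij : i ≠ j := fun h => hM (by rw [h])
  have h0 : M j i - M i j ≠ 0 := sub_ne_zero.2 hM.symm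
  -- Pairing M with E_ij - E_ji gives M_ji - M_ij, so this multiple takes the value t.
  refine ⟨⟨single i j (t / (M j i - M i j)) - single j i (t / (M j i - M i j)), ?_, ?_⟩, ?_⟩
  · intro k
    simp only [Matrix.sub_apply, Matrix.single_apply]
    grind
  · intro k l
    simp only [Matrix.sub_apply, Matrix.single_apply]
    grind
  · simp only [Matrix.mul_sub, trace_sub, trace_mul_single]
    simp
    field_simp

theorem trace_mul_transpose_mul {ι R : Type*} [Fintype ι] [CommRing R] (M : Matrix ι ι R)
    (h : Matrix Unit ι R) : (M * (hᵀ * h)).trace = h () ⬝ᵥ (M *ᵥ h ()) := by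
  simp only [trace, diag_apply, Matrix.mul_apply, dotProduct, mulVec, transpose_apply,
    Finset.univ_unique, Finset.sum_singleton, Finset.mul_sum]
  refine Finset.sum_congr rfl fun i _ => Finset.sum_congr rfl fun j _ => ?_
  change _ * (h () j * h () i) = _
  ring

/-- For symmetric M in characteristic 2 the cross terms of the quadratic form double up and vanish,
making it additive. It is onto because every element of a finite field of characteristic 2 is a
square. -/
theorem sum_addChar_quadratic_eq_zero {ι F : Type*} [Fintype ι] [DecidableEq ι] [Field F]
    [Fintype F] [CharP F 2] (ψ : AddChar F ℂ) (hψ : ψ ≠ 1) {M : Matrix ι ι F}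
    (hM : ∀ i j, M i j = M j i) {i : ι} (hi : M i i ≠ 0) :
    ∑ h : Matrix Unit ι F, ψ (h () ⬝ᵥ (M *ᵥ h ())) = 0 := by
  refine sum_addChar_eq_zero ψ hψ _ (fun a b => ?_) fun t => ?_
  · have h1 : b () ⬝ᵥ (M *ᵥ a ()) = a () ⬝ᵥ (M *ᵥ b ()) := by
      rw [dotProduct_mulVec, dotProduct_comm, ← mulVec_transpose]
      congr 2
      ext k l
      exact hM _ _
    change (a () + b ()) ⬝ᵥ (M *ᵥ (a () + b ())) = _
    rw [mulVec_add, add_dotProduct, dotProduct_add, dotProduct_add, h1]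
    linear_combination CharTwo.add_self_eq_zero (a () ⬝ᵥ (M *ᵥ b ()))
  · obtain ⟨x, hx⟩ := (bijective_frobenius F 2).2 (t / M i i)
    refine ⟨of fun _ => Pi.single i x, ?_⟩
    rw [frobenius_def] at hx
    change Pi.single i x ⬝ᵥ (M *ᵥ Pi.single i x) = t
    have h2 : Pi.single i x ⬝ᵥ (M *ᵥ Pi.single i x) = x ^ 2 * M i i := by
      simp; ring
    rw [h2, hx, div_mul_cancel₀ _ hi]

/-- The double sum factors: the sum over C tests symmetry of M, the sum over h tests its diagonal,
and in characteristic 2 the two together mean alternating. -/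
theorem sum_altMatrices_sum_row {ι F : Type*} [Fintype ι] [DecidableEq ι] [Field F] [Fintype F]
    [DecidableEq F] [CharP F 2] [Fintype (altMatrices ι F)] (ψ : AddChar F ℂ) (hψ : ψ ≠ 1)
    (M : Matrix ι ι F) [Decidable (M ∈ altMatrices ι F)] :
    ∑ C : altMatrices ι F, ∑ h : Matrix Unit ι F, ψ (M * (C.1 - hᵀ * h)).trace =
      if M ∈ altMatrices ι F then
        (Nat.card (altMatrices ι F) : ℂ) * Fintype.card F ^ Fintype.card ι else 0 := by
  have h1 : ∀ (C : altMatrices ι F) (h : Matrix Unit ι F), ψ (M * (C.1 - hᵀ * h)).trace =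
      ψ (M * C.1).trace * ψ (h () ⬝ᵥ (M *ᵥ h ())) := by
    intro C h
    rw [Matrix.mul_sub, trace_sub, CharTwo.sub_eq_add, AddChar.map_add_eq_mul,
      trace_mul_transpose_mul]
  simp_rw [h1]
  rw [← Finset.sum_mul_sum]
  by_cases hs : ∀ i j, M i j = M j i
  · by_cases hd : ∀ i, M i i = 0
    · have hM : M ∈ altMatrices ι F := ⟨hd, fun i j => by rw [CharTwo.neg_eq, hs]⟩
      rw [if_pos hM, Finset.sum_congr rfl (g := fun _ => (1 : ℂ))
        (fun C _ => by rw [trace_mul_eq_zero_of_symm hs C.2, AddChar.map_zero_eq_one]),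
        Finset.sum_congr rfl (g := fun _ => (1 : ℂ)) (s₁ := (Finset.univ : Finset (Matrix Unit ι F)))
        (fun h _ => by
          rw [dotProduct_mulVec_eq_zero_of_mem_altMatrices hM, AddChar.map_zero_eq_one])]
      have hc : Fintype.card (Matrix Unit ι F) = Fintype.card F ^ Fintype.card ι := by
        rw [← Nat.card_eq_fintype_card]
        change Nat.card (Unit → ι → F) = _
        simp
      simp [Nat.card_eq_fintype_card, hc]
    · push Not at hd
      obtain ⟨i, hi⟩ := hd
      rw [if_neg (fun h => hi (h.1 i)), sum_addChar_quadratic_eq_zero ψ hψ hs hi, mul_zero]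
  · push Not at hs
    obtain ⟨i, j, hij⟩ := hs
    rw [if_neg (fun h => hij (by rw [h.2 i j, CharTwo.neg_eq])),
      sum_altMatrices_eq_zero ψ hψ hij, zero_mul]

/-! ### Invertible block lower triangular matrices -/

/-- The block matrix `[S 0; g a]`. -/
def lowerBlock {m : ℕ} {R : Type*} [CommRing R] (S : Matrix (Fin m) (Fin m) R) (g : Fin m → R)
    (a : R) : Matrix (Fin (m + 1)) (Fin (m + 1)) R :=
  (fromBlocks S 0 (replicateRow (Fin 1) g) (of fun _ _ => a)).submatrix
    finSumFinEquiv.symm finSumFinEquiv.symm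

section lowerBlock

variable {m : ℕ} {R : Type*} [CommRing R] (S : Matrix (Fin m) (Fin m) R) (g : Fin m → R) (a : R)

@[simp] theorem lowerBlock_castSucc_castSucc (i j : Fin m) :
    lowerBlock S g a i.castSucc j.castSucc = S i j := by simp [lowerBlock]

@[simp] theorem lowerBlock_castSucc_last (i : Fin m) :
    lowerBlock S g a i.castSucc (Fin.last m) = 0 := by simp [lowerBlock]

@[simp] theorem lowerBlock_last_castSucc (j : Fin m) :
    lowerBlock S g a (Fin.last m) j.castSucc = g j := by simp [lowerBlock]

@[simp] theorem lowerBlock_last_last : lowerBlock S g a (Fin.last m) (Fin.last m) = a := by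
  simp [lowerBlock]

theorem det_lowerBlock : (lowerBlock S g a).det = S.det * a := by
  rw [lowerBlock, det_submatrix_equiv_self, det_fromBlocks_zero₁₂]
  simp

theorem eq_lowerBlock {A : Matrix (Fin (m + 1)) (Fin (m + 1)) R}
    (hA : ∀ i : Fin m, A i.castSucc (Fin.last m) = 0) :
    A = lowerBlock (A.submatrix Fin.castSucc Fin.castSucc)
      (fun j => A (Fin.last m) j.castSucc) (A (Fin.last m) (Fin.last m)) := by
  ext i j
  induction i using Fin.lastCases <;> induction j using Fin.lastCases <;> simp [hA]

end lowerBlock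

/-- The invertible matrices of the form `[S 0; g a]`. -/
noncomputable def lowerEquiv (m : ℕ) (F : Type*) [Field F] :
    GL (Fin m) F × (Fin m → F) × Fˣ ≃
      {A : GL (Fin (m + 1)) F // ∀ i : Fin m, A.1 i.castSucc (Fin.last m) = 0} where
  toFun p := ⟨GeneralLinearGroup.mkOfDetNeZero (lowerBlock p.1.1 p.2.1 p.2.2) (by
    rw [det_lowerBlock]
    exact mul_ne_zero (isUnits_det_units p.1).ne_zero p.2.2.ne_zero), fun i => by
      simp [GeneralLinearGroup.mkOfDetNeZero]⟩
  invFun A :=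
    have h : (A.1.1.submatrix Fin.castSucc Fin.castSucc).det *
        A.1.1 (Fin.last m) (Fin.last m) ≠ 0 := by
      rw [← det_lowerBlock _ (fun j => A.1.1 (Fin.last m) j.castSucc), ← eq_lowerBlock A.2]
      exact (isUnits_det_units A.1).ne_zero
    (GeneralLinearGroup.mkOfDetNeZero (A.1.1.submatrix Fin.castSucc Fin.castSucc)
      (left_ne_zero_of_mul h), fun j => A.1.1 (Fin.last m) j.castSucc,
      Units.mk0 (A.1.1 (Fin.last m) (Fin.last m)) (right_ne_zero_of_mul h))
  left_inv := by
    rintro ⟨S, g, a⟩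
    refine Prod.ext (Units.ext ?_) (Prod.ext ?_ (Units.ext ?_))
    · ext i j; simp [GeneralLinearGroup.mkOfDetNeZero]
    · ext j; simp [GeneralLinearGroup.mkOfDetNeZero]
    · simp [GeneralLinearGroup.mkOfDetNeZero]
  right_inv := by
    rintro ⟨A, hA⟩
    refine Subtype.ext (Units.ext ?_)
    exact (eq_lowerBlock hA).symm

theorem lowerEquiv_val (m : ℕ) (F : Type*) [Field F] (p : GL (Fin m) F × (Fin m → F) × Fˣ) :
    (lowerEquiv m F p).1.1 = lowerBlock p.1.1 p.2.1 p.2.2 := rfl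

/-- Compare the last columns in A⁻¹A = 1: only the corner of A contributes. -/
theorem inv_last_castSucc {m : ℕ} {F : Type*} [Field F] {A : GL (Fin (m + 1)) F}
    (hA : ∀ i : Fin m, A.1 i.castSucc (Fin.last m) = 0) :
    (∀ i : Fin m, (A⁻¹).1 i.castSucc (Fin.last m) = 0) ∧
      (A⁻¹).1 (Fin.last m) (Fin.last m) = (A.1 (Fin.last m) (Fin.last m))⁻¹ := by
  have h : (A⁻¹).1 * A.1 = 1 := by rw [← Units.val_mul, inv_mul_cancel]; rfl
  have h1 : ∀ i, (A⁻¹).1 i (Fin.last m) * A.1 (Fin.last m) (Fin.last m) =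
      (1 : Matrix (Fin (m + 1)) (Fin (m + 1)) F) i (Fin.last m) := by
    intro i
    rw [← h, Matrix.mul_apply, Fin.sum_univ_castSucc]
    simp [hA]
  have h2 := h1 (Fin.last m)
  rw [Matrix.one_apply_eq] at h2
  refine ⟨fun i => ?_, eq_inv_of_mul_eq_one_left h2⟩
  have h3 := h1 i.castSucc
  rw [Matrix.one_apply_ne (Fin.castSucc_lt_last i).ne] at h3
  exact (mul_eq_zero.1 h3).resolve_right (right_ne_zero_of_mul_eq_one h2)

/-- Isolates the factor |GL(m)|, which cancels against the order of P ∩ σ⁻¹Pσ. -/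
theorem card_GL_succ (m : ℕ) (F : Type*) [Field F] [Fintype F] :
    Nat.card (GL (Fin (m + 1)) F) = (Fintype.card F ^ (m + 1) - 1) * Fintype.card F ^ m *
      Nat.card (GL (Fin m) F) := by
  rw [card_GL_field, card_GL_field, Fin.prod_univ_succ]
  simp only [Fin.val_zero, pow_zero, Fin.val_succ, pow_succ, ← Nat.sub_mul]
  rw [Finset.prod_mul_distrib]
  simp
  ring

/-! ### The parabolic subgroup in characteristic two -/

section parabolic

variable {n : ℕ} {F : Type*} [Field F]

/-- The change in θ is the form of B + ᵗh h at y, which is zero, plus 2(hy)c, which vanishes only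
thanks to the characteristic. -/
theorem theta_levi_mul_unipotent_of_char_two [CharP F 2] (A : GL (Fin n) F)
    {B : Matrix (Fin n) (Fin n) F} {h : Matrix Unit (Fin n) F}
    (hB : B + hᵀ * h ∈ altMatrices (Fin n) F) (x : OddIdx n → F) :
    theta n F ((leviMatrix A * unipotentMatrix B h) *ᵥ x) = theta n F x := by
  obtain ⟨x1, y, c, rfl⟩ : ∃ (x1 y : Fin n → F) (c : Unit → F),
      x = Sum.elim (Sum.elim x1 y) c :=
    ⟨fun i => x (Sum.inl (Sum.inl i)), fun i => x (Sum.inl (Sum.inr i)), fun i => x (Sum.inr i), by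
      ext ((i | i) | i) <;> rfl⟩
  have h1 : (leviMatrix A * unipotentMatrix B h) *ᵥ (Sum.elim (Sum.elim x1 y) c)
      = Sum.elim (Sum.elim ((A : Matrix (Fin n) (Fin n) F) *ᵥ (x1 + B *ᵥ y))
        (((A⁻¹ : GL (Fin n) F) : Matrix (Fin n) (Fin n) F)ᵀ *ᵥ y)) (h *ᵥ y + c) := by
    rw [leviMatrix_mul_unipotentMatrix]
    simp [fromBlocks_mulVec, fromCols_mulVec, mulVec_mulVec, mulVec_add]
  have h2 : ((A : Matrix (Fin n) (Fin n) F) *ᵥ (x1 + B *ᵥ y)) ⬝ᵥ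
      (((A⁻¹ : GL (Fin n) F) : Matrix (Fin n) (Fin n) F)ᵀ *ᵥ y) = y ⬝ᵥ (x1 + B *ᵥ y) := by
    rw [mulVec_transpose, dotProduct_comm, ← dotProduct_mulVec, mulVec_mulVec, ← Units.val_mul,
      inv_mul_cancel, Units.val_one, one_mulVec]
  have h3 : y ⬝ᵥ ((hᵀ * h) *ᵥ y) = (h *ᵥ y) () * (h *ᵥ y) () := by
    rw [← mulVec_mulVec, mulVec_transpose, dotProduct_comm, ← dotProduct_mulVec]
    simp [dotProduct]
  have h4 := dotProduct_mulVec_eq_zero_of_mem_altMatrices hB y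
  rw [add_mulVec, dotProduct_add, h3] at h4
  rw [h1, theta_apply, theta_apply]
  have h5 : ∀ u v : Fin n → F, ∑ i, u i * v i = u ⬝ᵥ v := fun _ _ => rfl
  simp only [Sum.elim_inl, Sum.elim_inr, Pi.add_apply]
  rw [h5, h5, h2, dotProduct_add, dotProduct_comm y x1]
  linear_combination h4 + CharTwo.add_self_eq_zero ((h *ᵥ y) () * c ())

/-- The element `[A 0 0; 0 ᵗA⁻¹ 0; 0 0 1] [1 B 0; 0 1 0; 0 h 1]` of the parabolic subgroup, where
`B = C - ᵗh h`. -/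
noncomputable def parabolicElt [CharP F 2] (A : GL (Fin n) F) (C : altMatrices (Fin n) F)
    (h : Matrix Unit (Fin n) F) : OddOrthogonal n F :=
  ⟨GeneralLinearGroup.mkOfDetNeZero (leviMatrix A * unipotentMatrix (C.1 - hᵀ * h) h) (by
    rw [leviMatrix_mul_unipotentMatrix, det_fromBlocks_zero₁₂, det_fromBlocks_zero₂₁,
      det_transpose, det_one, mul_one]
    exact mul_ne_zero (isUnits_det_units A).ne_zero (isUnits_det_units A⁻¹).ne_zero),
    fun x => theta_levi_mul_unipotent_of_char_two A (by rw [sub_add_cancel]; exact C.2) x⟩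

theorem oddMat_parabolicElt [CharP F 2] (A : GL (Fin n) F) (C : altMatrices (Fin n) F)
    (h : Matrix Unit (Fin n) F) :
    oddMat (parabolicElt A C h) = leviMatrix A * unipotentMatrix (C.1 - hᵀ * h) h := rfl

/-- The parametrization of the parabolic subgroup in characteristic two. -/
noncomputable def parabolicEquiv (n : ℕ) (F : Type*) [Field F] [CharP F 2] :
    GL (Fin n) F × altMatrices (Fin n) F × Matrix Unit (Fin n) F ≃ maxParabolic n F :=
  Equiv.ofBijective (fun p => ⟨parabolicElt p.1 p.2.1 p.2.2, p.1, _, _, by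
      rw [sub_add_cancel]; exact p.2.1.2, oddMat_parabolicElt _ _ _⟩) (by
    constructor
    · rintro ⟨A, C, h⟩ ⟨A', C', h'⟩ e
      have e' : oddMat (parabolicElt A C h) = oddMat (parabolicElt A' C' h') :=
        congrArg (fun w : maxParabolic n F => oddMat w.1) e
      rw [oddMat_parabolicElt, oddMat_parabolicElt, leviMatrix_mul_unipotentMatrix,
        leviMatrix_mul_unipotentMatrix, fromBlocks_inj, fromBlocks_inj] at e'
      obtain ⟨⟨e1, e2, -, -⟩, -, e3, -⟩ := e'
      obtain rfl : A = A' := Units.ext e1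
      obtain rfl : h = h' := by
        ext i j
        exact congrFun (congrFun e3 i) (Sum.inr j)
      have e4 := congrArg (fun X => ((A⁻¹ : GL (Fin n) F) : Matrix (Fin n) (Fin n) F) * X) e2
      simp only [← Matrix.mul_assoc, ← Units.val_mul, inv_mul_cancel, Units.val_one,
        Matrix.one_mul, sub_left_inj] at e4
      rw [Subtype.ext e4]
    · rintro ⟨w, A, B, h, hB, hw⟩
      refine ⟨(A, ⟨B + hᵀ * h, hB⟩, h), Subtype.ext (Subtype.ext (Units.ext ?_))⟩
      change oddMat (parabolicElt A ⟨B + hᵀ * h, hB⟩ h) = oddMat w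
      rw [oddMat_parabolicElt, add_sub_cancel_right, hw])

theorem theta_col (w : OddOrthogonal n F) (k : OddIdx n) :
    theta n F (fun i => oddMat w i k) = theta n F (Pi.single k 1) := by
  rw [← w.2 (Pi.single k 1), mulVec_single_one]
  rfl

/-- Polarizing θ: the columns of an isometry satisfy the same bilinear relations as those of the
identity. -/
theorem polar_col (w : OddOrthogonal n F) (k l : OddIdx n) :
    ∑ i, (oddMat w (Sum.inl (Sum.inl i)) k * oddMat w (Sum.inl (Sum.inr i)) l +
      oddMat w (Sum.inl (Sum.inr i)) k * oddMat w (Sum.inl (Sum.inl i)) l) +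
      2 * oddMat w (Sum.inr ()) k * oddMat w (Sum.inr ()) l =
    ∑ i, ((1 : Matrix (OddIdx n) (OddIdx n) F) (Sum.inl (Sum.inl i)) k *
        (1 : Matrix (OddIdx n) (OddIdx n) F) (Sum.inl (Sum.inr i)) l +
      (1 : Matrix (OddIdx n) (OddIdx n) F) (Sum.inl (Sum.inr i)) k *
        (1 : Matrix (OddIdx n) (OddIdx n) F) (Sum.inl (Sum.inl i)) l) +
      2 * (1 : Matrix (OddIdx n) (OddIdx n) F) (Sum.inr ()) k *
        (1 : Matrix (OddIdx n) (OddIdx n) F) (Sum.inr ()) l := by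
  have key : ∀ X : Matrix (OddIdx n) (OddIdx n) F,
      ∑ i, (X (Sum.inl (Sum.inl i)) k * X (Sum.inl (Sum.inr i)) l +
        X (Sum.inl (Sum.inr i)) k * X (Sum.inl (Sum.inl i)) l) +
        2 * X (Sum.inr ()) k * X (Sum.inr ()) l =
      theta n F (X *ᵥ (Pi.single k 1 + Pi.single l 1)) - theta n F (X *ᵥ Pi.single k 1) -
        theta n F (X *ᵥ Pi.single l 1) := by
    intro X
    simp only [theta_apply, mulVec_add, mulVec_single_one, Pi.add_apply, col_apply, add_mul,
      mul_add, Finset.sum_add_distrib]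
    rw [Finset.sum_congr rfl fun x _ => mul_comm (X (Sum.inl (Sum.inr x)) k) _]
    ring
  rw [key, key, one_mulVec, one_mulVec, one_mulVec]
  congr 1
  · congr 1
    · exact w.2 _
    · exact w.2 _
  · exact w.2 _

/-- P is the stabilizer of the totally singular span of the first n coordinates. Once that span is
preserved, the polar relations give ᵗA Y = 1 for the middle diagonal block Y and clear the last
column above the corner; the corner then has square 1, so it equals 1 in characteristic 2. -/
theorem mem_maxParabolic_iff [CharP F 2] (w : OddOrthogonal n F) :
    w ∈ maxParabolic n F ↔
      (∀ i j, oddMat w (Sum.inl (Sum.inr i)) (Sum.inl (Sum.inl j)) = 0) ∧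
        ∀ j, oddMat w (Sum.inr ()) (Sum.inl (Sum.inl j)) = 0 := by
  constructor
  · rintro ⟨A, B, h, -, hw⟩
    rw [hw, leviMatrix_mul_unipotentMatrix]
    exact ⟨fun i j => rfl, fun j => rfl⟩
  · rintro ⟨hZ, hk⟩
    have h2 : (2 : F) = 0 := CharTwo.two_eq_zero
    set A : Matrix (Fin n) (Fin n) F := (oddMat w).toBlocks₁₁.toBlocks₁₁ with hA
    set X : Matrix (Fin n) (Fin n) F := (oddMat w).toBlocks₁₁.toBlocks₁₂ with hX
    set Y : Matrix (Fin n) (Fin n) F := (oddMat w).toBlocks₁₁.toBlocks₂₂ with hY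
    set u : Fin n → F := fun i => oddMat w (Sum.inl (Sum.inl i)) (Sum.inr ()) with hu
    set v : Fin n → F := fun i => oddMat w (Sum.inl (Sum.inr i)) (Sum.inr ()) with hv
    have hAY : Aᵀ * Y = 1 := by
      ext i j
      have := polar_col w (Sum.inl (Sum.inl i)) (Sum.inl (Sum.inr j))
      simp [hZ, h2, Matrix.one_apply] at this
      simp [Matrix.mul_apply, Matrix.one_apply, hA, hY, toBlocks₁₁, toBlocks₂₂, this, eq_comm]
    have hYA : Y * Aᵀ = 1 := mul_eq_one_comm.1 hAY
    have hAv : Aᵀ *ᵥ v = 0 := by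
      ext i
      have := polar_col w (Sum.inl (Sum.inl i)) (Sum.inr ())
      simp [hZ, h2, Matrix.one_apply] at this
      simpa [mulVec, dotProduct, hA, hv, toBlocks₁₁] using this
    have hv0 : v = 0 := by
      rw [← one_mulVec v, ← hYA, ← mulVec_mulVec, hAv, mulVec_zero]
    have hv1 : ∀ i, oddMat w (Sum.inl (Sum.inr i)) (Sum.inr ()) = 0 := congrFun hv0
    have hYu : Yᵀ *ᵥ u = 0 := by
      ext j
      have := polar_col w (Sum.inl (Sum.inr j)) (Sum.inr ())
      simp [hv1, h2, Matrix.one_apply] at this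
      simpa [mulVec, dotProduct, hY, hu, toBlocks₁₁, toBlocks₂₂] using this
    have hAYt : A * Yᵀ = 1 := by
      rw [← transpose_transpose A, ← transpose_mul, hYA, transpose_one]
    have hYtA : Yᵀ * A = 1 := mul_eq_one_comm.1 hAYt
    have hu0 : u = 0 := by
      rw [← one_mulVec u, ← hAYt, ← mulVec_mulVec, hYu, mulVec_zero]
    have hu1 : ∀ i, oddMat w (Sum.inl (Sum.inl i)) (Sum.inr ()) = 0 := congrFun hu0
    have hc : oddMat w (Sum.inr ()) (Sum.inr ()) = 1 := by
      have := theta_col w (Sum.inr ())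
      simp [theta_apply, hv1] at this
      rcases mul_self_eq_one_iff.1 this with h | h
      · exact h
      · rw [h, CharTwo.neg_eq]
    let A' : GL (Fin n) F := ⟨A, Yᵀ, hAYt, hYtA⟩
    have hw : oddMat w = leviMatrix A' * unipotentMatrix (Yᵀ * X)
        (of fun _ j => oddMat w (Sum.inr ()) (Sum.inl (Sum.inr j))) := by
      have e1 : (A' : Matrix (Fin n) (Fin n) F) * (Yᵀ * X) = X := by
        rw [← Matrix.mul_assoc]
        change A * Yᵀ * X = X
        rw [hAYt, Matrix.one_mul]
      have e2 : ((A'⁻¹ : GL (Fin n) F) : Matrix (Fin n) (Fin n) F)ᵀ = Y := transpose_transpose Y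
      rw [leviMatrix_mul_unipotentMatrix, e1, e2]
      ext ((i | i) | i) ((j | j) | j)
      · rfl
      · rfl
      · exact hu1 i
      · exact hZ i j
      · rfl
      · exact hv1 i
      · exact hk j
      · rfl
      · exact hc
    exact ⟨_, _, _, isAlternatingMatrix_of_mat_eq w hw, hw⟩

/-! ### The order of P ∩ σ⁻¹Pσ -/

/-- The permutation of the coordinates underlying `sigmaMatrix`. -/
def sigmaIdx (n r : ℕ) : OddIdx n → OddIdx n
  | Sum.inl (Sum.inl i) => if (i : ℕ) < r then Sum.inl (Sum.inr i) else Sum.inl (Sum.inl i)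
  | Sum.inl (Sum.inr i) => if (i : ℕ) < r then Sum.inl (Sum.inl i) else Sum.inl (Sum.inr i)
  | Sum.inr i => Sum.inr i

theorem sigmaMatrix_apply (r : ℕ) (i j : OddIdx n) :
    sigmaMatrix n F r i j = if sigmaIdx n r i = j then 1 else 0 := by
  rcases i with ((i | i) | i) <;> rcases j with ((j | j) | j) <;>
    simp only [sigmaMatrix, sigmaIdx, fromBlocks_apply₁₁, fromBlocks_apply₁₂, fromBlocks_apply₂₁,
      fromBlocks_apply₂₂, diagonal_apply] <;> split_ifs <;> simp_all

theorem sigmaMatrix_mul_mul (r : ℕ) (W : Matrix (OddIdx n) (OddIdx n) F) (i j : OddIdx n) :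
    (sigmaMatrix n F r * W * sigmaMatrix n F r) i j = W (sigmaIdx n r i) (sigmaIdx n r j) := by
  have ht : ∀ k, sigmaMatrix n F r k j = sigmaMatrix n F r j k := by
    intro k
    rcases j with ((j | j) | j) <;> rcases k with ((i | i) | i) <;>
      simp only [sigmaMatrix, fromBlocks_apply₁₁, fromBlocks_apply₁₂, fromBlocks_apply₂₁,
      fromBlocks_apply₂₂, diagonal_apply, Matrix.one_apply, Matrix.zero_apply] <;> grind
  rw [Matrix.mul_apply]
  simp_rw [ht, Matrix.mul_apply, sigmaMatrix_apply]
  simp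

theorem oddMat_sigma_conj (r : ℕ) (w : OddOrthogonal n F) (i j : OddIdx n) :
    oddMat (sigma n F r * w * (sigma n F r)⁻¹) i j =
      oddMat w (sigmaIdx n r i) (sigmaIdx n r j) :=
  sigmaMatrix_mul_mul r (oddMat w) i j

end parabolic

/-- Conjugation permutes matrix entries, so membership asks certain entries of A, A⁻¹, AB and h to
vanish. The condition on A⁻¹ follows from that on A. With h supported on its last entry, ᵗh h does
not affect the first m columns of AB, and A, being block lower triangular, carries the condition on
AC back to C. -/
theorem sigma_conj_mem_iff {m : ℕ} {F : Type*} [Field F] [CharP F 2] (A : GL (Fin (m + 1)) F)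
    (C : altMatrices (Fin (m + 1)) F) (h : Matrix Unit (Fin (m + 1)) F) :
    sigma (m + 1) F m * parabolicElt A C h * (sigma (m + 1) F m)⁻¹ ∈ maxParabolic (m + 1) F ↔
      (∀ i : Fin m, A.1 i.castSucc (Fin.last m) = 0) ∧
      (∀ i j : Fin m, C.1 i.castSucc j.castSucc = 0) ∧
      ∀ j : Fin m, h () j.castSucc = 0 := by
  have key : ∀ i j : Fin m, (∀ j : Fin m, h () j.castSucc = 0) →
      (A.1 * (C.1 - hᵀ * h)) i.castSucc j.castSucc = (A.1 * C.1) i.castSucc j.castSucc := by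
    intro i j hh
    rw [Matrix.mul_sub, Matrix.sub_apply, sub_eq_self, ← Matrix.mul_assoc, Matrix.mul_apply]
    simp [hh]
  rw [mem_maxParabolic_iff]
  simp only [oddMat_sigma_conj, oddMat_parabolicElt, leviMatrix_mul_unipotentMatrix, sigmaIdx,
    Fin.forall_fin_succ']
  simp
  constructor
  · rintro ⟨⟨h1, h2⟩, h3⟩
    have hA : ∀ i : Fin m, A.1 i.castSucc (Fin.last m) = 0 := fun i => (h1 i).2
    have hA' := (inv_last_castSucc hA).1
    refine ⟨hA, fun i j => ?_, h3⟩
    have e : C.1 = (A⁻¹).1 * (A.1 * C.1) := by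
      rw [← Matrix.mul_assoc, ← Units.val_mul, inv_mul_cancel, Units.val_one, Matrix.one_mul]
    rw [e, Matrix.mul_apply, Fin.sum_univ_castSucc, hA', zero_mul, add_zero]
    refine Finset.sum_eq_zero fun k _ => ?_
    rw [← key _ _ h3, (h1 k).1 j, mul_zero]
  · rintro ⟨hA, hC, h3⟩
    refine ⟨⟨fun i => ⟨fun j => ?_, hA i⟩, ?_⟩, h3⟩
    · rw [key _ _ h3, Matrix.mul_apply, Fin.sum_univ_castSucc, hA, zero_mul, add_zero]
      exact Finset.sum_eq_zero fun k _ => by rw [hC, mul_zero]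
    · simpa using (inv_last_castSucc hA).1

section

variable {m : ℕ} {F : Type*} [Field F]

/-- Alternating matrices supported on the last row and column. -/
def altLastEquiv (m : ℕ) (F : Type*) [Field F] :
    {C : altMatrices (Fin (m + 1)) F // ∀ i j : Fin m, C.1 i.castSucc j.castSucc = 0} ≃
      (Fin m → F) where
  toFun C j := C.1.1 (Fin.last m) j.castSucc
  invFun g := ⟨⟨lowerBlock 0 g 0 - (lowerBlock 0 g 0)ᵀ, fun i => by simp, fun i j => by simp⟩,
    fun i j => by simp⟩
  left_inv := by
    rintro ⟨⟨C, hC⟩, hC'⟩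
    refine Subtype.ext (Subtype.ext ?_)
    ext i j
    induction i using Fin.lastCases <;> induction j using Fin.lastCases
    · simp [hC.1]
    · simp
    · rename_i i
      simp [hC.2 i.castSucc]
    · simpa using (hC' _ _).symm
  right_inv g := by
    ext j
    simp

/-- Row vectors supported on the last coordinate. -/
def rowLastEquiv (m : ℕ) (F : Type*) [Field F] :
    {h : Matrix Unit (Fin (m + 1)) F // ∀ j : Fin m, h () j.castSucc = 0} ≃ F where
  toFun h := h.1 () (Fin.last m)
  invFun x := ⟨of fun _ => Pi.single (Fin.last m) x, fun j => by
    simp⟩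
  left_inv := by
    rintro ⟨h, hh⟩
    refine Subtype.ext ?_
    ext i j
    induction j using Fin.lastCases <;> simp [hh]
  right_inv x := by simp

theorem card_sigma_conj [Fintype F] [CharP F 2] :
    Nat.card {a : maxParabolic (m + 1) F //
      sigma (m + 1) F m * a * (sigma (m + 1) F m)⁻¹ ∈ maxParabolic (m + 1) F} =
    Nat.card (GL (Fin m) F) * Fintype.card F ^ m * (Fintype.card F - 1) *
      Fintype.card F ^ m * Fintype.card F := by
  have e : {a : maxParabolic (m + 1) F //
      sigma (m + 1) F m * a * (sigma (m + 1) F m)⁻¹ ∈ maxParabolic (m + 1) F} ≃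
      {A : GL (Fin (m + 1)) F // ∀ i : Fin m, A.1 i.castSucc (Fin.last m) = 0} ×
      {C : altMatrices (Fin (m + 1)) F // ∀ i j : Fin m, C.1 i.castSucc j.castSucc = 0} ×
      {h : Matrix Unit (Fin (m + 1)) F // ∀ j : Fin m, h () j.castSucc = 0} :=
    ((parabolicEquiv (m + 1) F).subtypeEquiv (p := fun p =>
      (∀ i : Fin m, p.1.1 i.castSucc (Fin.last m) = 0) ∧
      (∀ i j : Fin m, p.2.1.1 i.castSucc j.castSucc = 0) ∧
      ∀ j : Fin m, p.2.2 () j.castSucc = 0) fun p =>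
        (sigma_conj_mem_iff p.1 p.2.1 p.2.2).symm).symm.trans
    { toFun := fun x => (⟨x.1.1, x.2.1⟩, ⟨x.1.2.1, x.2.2.1⟩, ⟨x.1.2.2, x.2.2.2⟩)
      invFun := fun x => ⟨(x.1.1, x.2.1.1, x.2.2.1), x.1.2, x.2.1.2, x.2.2.2⟩
      left_inv := fun _ => rfl
      right_inv := fun _ => rfl }
  classical
  rw [Nat.card_congr e, Nat.card_prod, Nat.card_prod, ← Nat.card_congr (lowerEquiv m F),
    Nat.card_congr (altLastEquiv m F), Nat.card_congr (rowLastEquiv m F), Nat.card_prod,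
    Nat.card_prod]
  simp [Nat.card_eq_fintype_card, Fintype.card_units]
  ring

theorem card_maxParabolic [Fintype F] [CharP F 2] (n : ℕ) :
    Nat.card (maxParabolic n F) =
      Nat.card (GL (Fin n) F) * Fintype.card F ^ (n * (n - 1) / 2) * Fintype.card F ^ n := by
  have hc : Nat.card (Matrix Unit (Fin n) F) = Fintype.card F ^ n := by
    change Nat.card (Unit → Fin n → F) = _
    simp
  rw [← Nat.card_congr (parabolicEquiv n F), Nat.card_prod, Nat.card_prod, card_altMatrices, hc]
  ring

/-! ### The character sum over Pσ -/

theorem trace_fromBlocks_eq_add {ι κ R : Type*} [Fintype ι] [Fintype κ] [CommRing R]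
    (A : Matrix ι ι R) (B : Matrix ι κ R) (C : Matrix κ ι R) (D : Matrix κ κ R) :
    (fromBlocks A B C D).trace = A.trace + D.trace := by
  simp [trace, Fintype.sum_sum_type]

/-- The diagonal matrix projecting onto all coordinates but the last. -/
def initProj (m : ℕ) (F : Type*) [Field F] : Matrix (Fin (m + 1)) (Fin (m + 1)) F :=
  diagonal fun i => if (i : ℕ) < m then 1 else 0

/-- The diagonal blocks of σ select the last diagonal entries of A and ᵗA⁻¹, and its off-diagonal
block is E. Hence h enters only through B, and B only linearly. -/
theorem trace_levi_mul_unipotent_mul_sigma (A : GL (Fin (m + 1)) F)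
    (B : Matrix (Fin (m + 1)) (Fin (m + 1)) F) (h : Matrix Unit (Fin (m + 1)) F) :
    (leviMatrix A * unipotentMatrix B h * sigmaMatrix (m + 1) F m).trace =
      A.1 (Fin.last m) (Fin.last m) + (A⁻¹).1 (Fin.last m) (Fin.last m) + 1 +
        (initProj m F * A.1 * B).trace := by
  have hd : ∀ X : Matrix (Fin (m + 1)) (Fin (m + 1)) F,
      (X * diagonal fun i : Fin (m + 1) => if (i : ℕ) < m then 0 else 1).trace =
        X (Fin.last m) (Fin.last m) := by
    intro X
    simp [trace, Matrix.mul_diagonal, Fin.sum_univ_castSucc]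
  rw [leviMatrix_mul_unipotentMatrix, sigmaMatrix, fromBlocks_multiply, fromBlocks_multiply,
    trace_fromBlocks_eq_add]
  simp only [Matrix.mul_zero, Matrix.zero_mul, add_zero, zero_add, Matrix.mul_one]
  rw [trace_fromBlocks_eq_add, trace_add, hd, hd, Matrix.mul_assoc (initProj m F),
    trace_mul_comm (initProj m F), initProj, transpose_apply]
  simp
  ring

theorem initProj_mul_lowerBlock (S : Matrix (Fin m) (Fin m) F) (g : Fin m → F) (a : F) :
    initProj m F * lowerBlock S g a = lowerBlock S 0 0 := by
  ext i j
  rw [initProj, diagonal_mul]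
  induction i using Fin.lastCases <;> induction j using Fin.lastCases <;> simp

theorem lowerBlock_zero_mem_iff (S : Matrix (Fin m) (Fin m) F) :
    lowerBlock S 0 0 ∈ altMatrices (Fin (m + 1)) F ↔ S ∈ altMatrices (Fin m) F := by
  simp [mem_altMatrices, Fin.forall_fin_succ', forall_and]

/-- The last row of EA is zero, hence by antisymmetry so is its last column. -/
theorem castSucc_last_eq_zero_of_initProj_mul_mem {A : Matrix (Fin (m + 1)) (Fin (m + 1)) F}
    (hA : initProj m F * A ∈ altMatrices (Fin (m + 1)) F) (i : Fin m) :
    A i.castSucc (Fin.last m) = 0 := by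
  have := hA.2 i.castSucc (Fin.last m)
  simpa [initProj, diagonal_mul] using this

theorem card_GL_alternating (ι F : Type*) [Fintype ι] [DecidableEq ι] [Field F] :
    Nat.card {S : GL ι F // S.1 ∈ altMatrices ι F} = numAltNonsing ι F :=
  Nat.card_congr
    { toFun := fun S => ⟨⟨S.1.1, S.2⟩, (isUnits_det_units S.1).ne_zero⟩
      invFun := fun M => ⟨GeneralLinearGroup.mkOfDetNeZero M.1.1 M.2, M.1.2⟩
      left_inv := fun _ => Subtype.ext (Units.ext rfl)
      right_inv := fun _ => rfl }

/-- In A = [S 0; g a] the condition on EA concerns S alone and the character value a alone, while g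
is free. The sum splits as a count of S, the factor q^m and a Kloosterman sum. -/
theorem sum_GL_alternating [Fintype F] [DecidableEq F] (ψ : AddChar F ℂ)
    [DecidablePred fun A : GL (Fin (m + 1)) F => initProj m F * A.1 ∈ altMatrices _ F] :
    ∑ A : GL (Fin (m + 1)) F, (if initProj m F * A.1 ∈ altMatrices _ F then
      ψ (A.1 (Fin.last m) (Fin.last m) + (A⁻¹).1 (Fin.last m) (Fin.last m) + 1) else 0) =
    ψ 1 * numAltNonsing (Fin m) F * Fintype.card F ^ m * kloosterman ψ 1 := by
  classical
  let c : GL (Fin m) F → ℂ := fun S => if S.1 ∈ altMatrices (Fin m) F then 1 else 0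
  have h1 : ∀ p : GL (Fin m) F × (Fin m → F) × Fˣ,
      (if initProj m F * (lowerEquiv m F p).1.1 ∈ altMatrices _ F then
        ψ ((lowerEquiv m F p).1.1 (Fin.last m) (Fin.last m) +
          ((lowerEquiv m F p).1⁻¹).1 (Fin.last m) (Fin.last m) + 1) else 0) =
      c p.1 * (ψ 1 * ψ ((p.2.2 : F) + ((1 : Fˣ) : F) * ((p.2.2⁻¹ : Fˣ) : F))) := by
    intro p
    have h2 := (inv_last_castSucc (lowerEquiv m F p).2).2
    have h3 : initProj m F * (lowerEquiv m F p).1.1 ∈ altMatrices _ F ↔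
        p.1.1 ∈ altMatrices (Fin m) F := by
      rw [lowerEquiv_val, initProj_mul_lowerBlock, lowerBlock_zero_mem_iff]
    have h5 : (lowerEquiv m F p).1.1 (Fin.last m) (Fin.last m) = p.2.2 :=
      lowerBlock_last_last _ _ _
    rw [h2, h5]
    simp only [h3, c]
    rw [AddChar.map_add_eq_mul, mul_comm]
    simp
  have h4 : ∑ S : GL (Fin m) F, c S = numAltNonsing (Fin m) F := by
    rw [← card_GL_alternating, Nat.card_eq_fintype_card, Fintype.card_subtype, Finset.sum_boole]
  rw [← Finset.sum_subset (Finset.subset_univ (Finset.univ.filter fun A : GL (Fin (m + 1)) F =>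
      ∀ i : Fin m, A.1 i.castSucc (Fin.last m) = 0))
    (fun A _ hA => if_neg fun h => hA (Finset.mem_filter.2 ⟨Finset.mem_univ _,
      castSucc_last_eq_zero_of_initProj_mul_mem h⟩)),
    Finset.sum_subtype _ (p := fun A : GL (Fin (m + 1)) F =>
      ∀ i : Fin m, A.1 i.castSucc (Fin.last m) = 0) (fun A => by simp),
    ← Fintype.sum_equiv (lowerEquiv m F) _ _ (fun p => rfl), Finset.sum_congr rfl fun p _ => h1 p,
    Fintype.sum_prod_type]
  simp only [Fintype.sum_prod_type, ← Finset.mul_sum]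
  rw [← Finset.sum_mul, h4, kloosterman, Finset.sum_const, nsmul_eq_mul, Finset.card_univ]
  simp
  ring

theorem sum_maxParabolic_mul_sigma [Fintype F] [DecidableEq F] [CharP F 2] (ψ : AddChar F ℂ)
    (hψ : ψ ≠ 1) [Fintype (maxParabolic (m + 1) F)] :
    ∑ p : maxParabolic (m + 1) F, ψ (oddMat ((p : OddOrthogonal (m + 1) F) * sigma (m + 1) F m)).trace =
      Fintype.card F ^ ((m + 1) * (m + 1 - 1) / 2) * Fintype.card F ^ (m + 1) *
        (ψ 1 * numAltNonsing (Fin m) F * Fintype.card F ^ m * kloosterman ψ 1) := by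
  classical
  have h1 : ∀ p : GL (Fin (m + 1)) F × altMatrices (Fin (m + 1)) F × Matrix Unit (Fin (m + 1)) F,
      ψ (oddMat ((parabolicEquiv (m + 1) F p : OddOrthogonal (m + 1) F) * sigma (m + 1) F m)).trace =
        ψ (p.1.1 (Fin.last m) (Fin.last m) + (p.1⁻¹).1 (Fin.last m) (Fin.last m) + 1) *
          ψ (initProj m F * p.1.1 * (p.2.1.1 - p.2.2ᵀ * p.2.2)).trace := by
    intro p
    rw [← AddChar.map_add_eq_mul, ← trace_levi_mul_unipotent_mul_sigma]
    rfl
  rw [← Fintype.sum_equiv (parabolicEquiv (m + 1) F) _ _ (fun p => rfl),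
    Finset.sum_congr rfl fun p _ => h1 p, Fintype.sum_prod_type]
  simp_rw [Fintype.sum_prod_type, ← Finset.mul_sum, sum_altMatrices_sum_row ψ hψ]
  rw [← sum_GL_alternating, Finset.mul_sum]
  refine Finset.sum_congr rfl fun A _ => ?_
  rw [card_altMatrices, Fintype.card_fin]
  split_ifs
  · push_cast
    ring
  · simp

end

/-! ### Assembly of the formula -/

theorem theorem2 (F : Type*) [Field F] [Fintype F] [DecidableEq F] (q r : ℕ) (hr : 0 < r)
    (hq : q = 2 ^ r) (hF : Fintype.card F = q) (ψ : AddChar F ℂ) (hψ : ψ ≠ 1)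
    (n : ℕ) (hn : Odd n) :
    ∑ w ∈ (Set.toFinite (DC n F)).toFinset, ψ (Matrix.trace (oddMat w)) =
      ψ 1 * (Acoeff n q : ℂ) * kloosterman ψ 1 := by
  classical
  have : Fact (Nat.Prime 2) := ⟨Nat.prime_two⟩
  have : CharP F 2 := charP_of_card_eq_prime_pow (f := r) (by rw [hF, hq])
  obtain ⟨k, rfl⟩ := hn
  have hq2 : 2 ≤ q := by
    rw [hq]
    exact Nat.le_self_pow hr.ne' 2
  have key := card_mul_sum_doubleCoset (maxParabolic (2 * k + 1) F) (sigma (2 * k + 1) F (2 * k))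
    (fun w => ψ (oddMat w).trace) (fun a b => by
      change ψ (oddMat a * oddMat b).trace = ψ (oddMat b * oddMat a).trace
      rw [trace_mul_comm])
  change _ * ∑ w ∈ (Set.toFinite (DC (2 * k + 1) F)).toFinset, ψ (oddMat w).trace = _ at key
  rw [card_sigma_conj, card_maxParabolic, card_GL_succ, sum_maxParabolic_mul_sigma ψ hψ,
    numAltNonsing_fin, hF] at key
  have hGL : (Nat.card (GL (Fin (2 * k)) F) : ℂ) ≠ 0 := Nat.cast_ne_zero.2 Nat.card_pos.ne'
  have hq0 : (q : ℂ) ≠ 0 := Nat.cast_ne_zero.2 (by omega)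
  have hq1 : (q : ℂ) - 1 ≠ 0 := by
    rw [sub_ne_zero]
    exact_mod_cast (by omega : q ≠ 1)
  have hpow : ∀ j, ((q ^ j - 1 : ℕ) : ℂ) = (q : ℂ) ^ j - 1 := fun j => by
    rw [Nat.cast_sub (Nat.one_le_pow _ _ (by omega))]
    simp
  have hA : (Acoeff (2 * k + 1) q : ℂ) = (q : ℂ) ^ (5 * k ^ 2 + 5 * k + 1) *
      (((q : ℂ) ^ (2 * k + 1) - 1) / (q - 1)) * ∏ j ∈ Finset.range k, ((q : ℂ) ^ (2 * j + 1) - 1) := by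
    have e1 : (5 * (2 * k + 1) ^ 2 - 1) / 4 = 5 * k ^ 2 + 5 * k + 1 := by
      have : 5 * (2 * k + 1) ^ 2 = 4 * (5 * k ^ 2 + 5 * k + 1) + 1 := by ring
      omega
    have e2 : (2 * k + 1 - 1) / 2 = k := by omega
    rw [Acoeff, e1, e2, qBinomial, Finset.prod_range_one, ← Finset.Ico_add_one_right_eq_Icc,
      Finset.prod_Ico_eq_prod_range]
    push_cast
    congr 1
    · simp
    · refine Finset.prod_congr (by simp) fun j _ => ?_
      congr 2
      omega
  have e3 : (2 * k + 1) * (2 * k + 1 - 1) / 2 = (2 * k + 1) * k := by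
    rw [show (2 * k + 1) * (2 * k + 1 - 1) = (2 * k + 1) * k * 2 by simp; ring]
    simp
  have e4 : k * (k - 1) + k = k ^ 2 := by
    cases k <;> simp; ring
  rw [e3] at key
  push_cast [hpow] at key
  have h1 : ((q - 1 : ℕ) : ℂ) = q - 1 := by simpa using hpow 1
  rw [h1] at key
  -- This factor is the order of P ∩ σ⁻¹Pσ with m = 2k.
  refine mul_left_cancel₀ (mul_ne_zero (mul_ne_zero hGL hq1) (pow_ne_zero (4 * k + 1) hq0)) ?_
  -- Powers of q on the left, in order: |GL(2k+1)| / |GL(2k)|, then C and h in |P|, C and h again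
  -- from the character sums, the count of S, and the row g.
  have e5 : (q : ℂ) ^ (2 * k) * q ^ ((2 * k + 1) * k) * q ^ (2 * k + 1) *
      (q ^ ((2 * k + 1) * k) * q ^ (2 * k + 1)) * q ^ (k * (k - 1)) * q ^ (2 * k) =
      q ^ (4 * k + 1) * q ^ (5 * k ^ 2 + 5 * k + 1) := by
    simp only [← pow_add]
    congr 1
    linarith
  rw [hA]
  generalize ∏ j ∈ Finset.range k, ((q : ℂ) ^ (2 * j + 1) - 1) = P at key ⊢
  -- Naming the quotient d removes the division, leaving a polynomial identity.
  obtain ⟨d, hd, h2⟩ : ∃ d : ℂ, ((q : ℂ) ^ (2 * k + 1) - 1) / (q - 1) = d ∧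
      (q : ℂ) ^ (2 * k + 1) - 1 = (q - 1) * d :=
    ⟨_, rfl, (mul_div_cancel₀ _ hq1).symm⟩
  rw [h2] at key
  rw [hd]
  linear_combination key + (Nat.card (GL (Fin (2 * k)) F) : ℂ) * (q - 1) * d *
    (ψ 1 * P * kloosterman ψ 1) * e5
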